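/- Let $m,n_0\ge 1$, $T>0$, $\beta\in\mathbb{R}$, $\delta>0$, and $h(z)=\exp\{z/T\}$. There are $m$ tasks; for each task $i$ let $\mu_i$ be a probability distribution of pairs $(\mathbf{x},y)$ with $\mathbf{x}\in\mathbb{R}^d$, $\|\mathbf{x}\|_2\le 1$ almost surely, and $y$ in a measurable label space $\mathcal{Y}$. Let $(\mathbf{x}^i_j,y^i_j)$, $1\le i\le m$, $1\le j\le n_0$, be independent with $(\mathbf{x}^i_j,y^i_j)\sim\mu_i$. Let $l:\mathbb{R}\times\mathcal{Y}\to[0,1]$ be a (measurable) loss function that is $\rho$-Lipschitz in its first argument. For $\bm{\Theta}\in\mathbb{R}^{d\times m}$ with columns $\bm{\theta}_1,\ldots,\bm{\theta}_m$ put $f_i(\mathbf{x};\bm{\Theta})=\langle\bm{\theta}_i,\mathbf{x}\rangle$ and $$R_i(\bm{\Theta})=\mathbb{E}_{(\mathbf{x},y)\sim\mu_i}[l(f_i(\mathbf{x};\bm{\Theta}),y)],\qquad R_h(\bm{\Theta})=\frac1m\sum_{i=1}^m h(R_i(\bm{\Theta})),$$ $$\hat R_i(\bm{\Theta})=\frac1{n_0}\sum_{j=1}^{n_0}l(f_i(\mathbf{x}^i_j;\bm{\Theta}),y^i_j),\qquad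 \hat R_h(\bm{\Theta})=\frac1m\sum_{i=1}^m h(\hat R_i(\bm{\Theta})).$$ Let $\mathcal{C}=\{\bm{\Theta}\in\mathbb{R}^{d\times m} : \|\bm{\Theta}\|_F\le\beta\}$, $\eta=\frac2m\exp\{\frac1T\}\left(\exp\{\frac1{n_0T}\}-1\right)$ and $\nu=\frac1T\exp\{\frac1T\}$. Then, with probability at least $1-\delta$ over the sample, simultaneously for all $\bm{\Theta}\in\mathcal{C}$, $$R_h(\bm{\Theta})\le\hat R_h(\bm{\Theta})+\frac{8\rho\nu\beta}{\sqrt m}+\sqrt{\frac{\eta^2mn_0}{2}\ln\frac1\delta}.$$ (For $\delta\ge 1$ the claim is vacuous; there the square root of a negative number is read as $0$.) -/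

import Mathlib

open MeasureTheory ProbabilityTheory
open scoped NNReal

noncomputable section

namespace BMTL

/-- The transformation function `h(z) = exp(z / T)`. -/
def transform (T z : ℝ) : ℝ := Real.exp (z / T)

/-- The linear learning function of task `i`: `f_i(x; Θ) = ⟨θ_i, x⟩`, with `θ_i` the `i`-th column
of the parameter matrix `Θ`. -/
def linearModel {d m : ℕ} (Θ : Matrix (Fin d) (Fin m) ℝ) (i : Fin m)
    (x : EuclideanSpace ℝ (Fin d)) : ℝ :=
  inner ℝ (WithLp.toLp 2 (fun k => Θ k i) : EuclideanSpace ℝ (Fin d)) x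

section Frobenius

open scoped Matrix.Norms.Frobenius

/-- The constraint set `C = {Θ | ‖Θ‖_F ≤ β}`, where `‖·‖_F` is the Frobenius norm. -/
def constraintSet (d m : ℕ) (β : ℝ) : Set (Matrix (Fin d) (Fin m) ℝ) := {Θ | ‖Θ‖ ≤ β}

end Frobenius

/-- The expected loss of task `i`: `R_i(Θ) = E_{(x,y) ∼ μ_i} [l(f_i(x; Θ), y)]`. -/
def taskRisk {d m : ℕ} {𝒴 : Type*} [MeasurableSpace 𝒴] (l : ℝ → 𝒴 → ℝ)
    (μ : Fin m → Measure (EuclideanSpace ℝ (Fin d) × 𝒴))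
    (Θ : Matrix (Fin d) (Fin m) ℝ) (i : Fin m) : ℝ :=
  ∫ z, l (linearModel Θ i z.1) z.2 ∂(μ i)

/-- The expected loss `R_h(Θ) = (1/m) ∑ i, h(R_i(Θ))`. -/
def risk {d m : ℕ} {𝒴 : Type*} [MeasurableSpace 𝒴] (T : ℝ) (l : ℝ → 𝒴 → ℝ)
    (μ : Fin m → Measure (EuclideanSpace ℝ (Fin d) × 𝒴))
    (Θ : Matrix (Fin d) (Fin m) ℝ) : ℝ :=
  1 / (m : ℝ) * ∑ i, transform T (taskRisk l μ Θ i)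

/-- The empirical loss of task `i` on a sample `z`, where `z i j = (x^i_j, y^i_j)`:
`(1/n₀) ∑ j, l(f_i(x^i_j; Θ), y^i_j)`. -/
def empTaskRisk {d m n₀ : ℕ} {𝒴 : Type*} (l : ℝ → 𝒴 → ℝ)
    (z : Fin m → Fin n₀ → EuclideanSpace ℝ (Fin d) × 𝒴)
    (Θ : Matrix (Fin d) (Fin m) ℝ) (i : Fin m) : ℝ :=
  1 / (n₀ : ℝ) * ∑ j, l (linearModel Θ i (z i j).1) (z i j).2

/-- The empirical loss for all the tasks: the average over `i` of `h` of the empirical loss of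
task `i`. -/
def empRisk {d m n₀ : ℕ} {𝒴 : Type*} (T : ℝ) (l : ℝ → 𝒴 → ℝ)
    (z : Fin m → Fin n₀ → EuclideanSpace ℝ (Fin d) × 𝒴)
    (Θ : Matrix (Fin d) (Fin m) ℝ) : ℝ :=
  1 / (m : ℝ) * ∑ i, transform T (empTaskRisk l z Θ i)

/-- The quantity `ν = (1/T) exp(1/T)`. -/
def nu (T : ℝ) : ℝ := 1 / T * Real.exp (1 / T)

/-- The quantity `η = (2/m) exp(1/T) (exp(1/(n₀ T)) - 1)`. -/
def eta (m n₀ : ℕ) (T : ℝ) : ℝ :=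
  2 / (m : ℝ) * Real.exp (1 / T) * (Real.exp (1 / ((n₀ : ℝ) * T)) - 1)

end BMTL

end

namespace BMTL

variable {d m n₀ : ℕ} {𝒴 : Type*}

/-! No complexity bound for the class is needed: everything is compared with `Θ = 0`. On inputs in
the unit ball, each expected or empirical task loss moves by at most `ρ‖θ_i‖` between `0` and `Θ`,
and `h` has slope at most `ν` on `(-∞, 1]`. Since `∑ ‖θ_i‖ ≤ √m β` by Cauchy–Schwarz, the gap `R_h -
R̂_h` at `Θ` exceeds the gap at `0` by at most `2ρνβ/√m`, uniformly over the constraint set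
(`risk_sub_empRisk_le_at_zero`).

It remains to control one fixed parameter. Convexity of `h` bounds the gap by a sum of independent
centred variables, to which Hoeffding's inequality applies (`measureReal_risk_sub_empRisk_ge_le`).
Both constants of the theorem leave slack: `2` against `8`, and failure probability `δ⁴` against
`δ`. -/

/-- The tangent line inequality for the convex function `transform T`. -/
lemma transform_sub_le_tangent (T a b : ℝ) :
    transform T a - transform T b ≤ Real.exp (a / T) * (1 / T) * (a - b) := by
  have h := Real.add_one_le_exp ((b - a) / T)
  have hb : Real.exp (b / T) = Real.exp (a / T) * Real.exp ((b - a) / T) := by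
    rw [← Real.exp_add]; congr 1; ring
  have h2 := mul_le_mul_of_nonneg_left h (Real.exp_pos (a / T)).le
  simp only [transform]
  rw [hb]
  calc Real.exp (a / T) - Real.exp (a / T) * Real.exp ((b - a) / T)
      ≤ Real.exp (a / T) - Real.exp (a / T) * ((b - a) / T + 1) := by linarith
    _ = _ := by ring

/-- Only `a` needs an upper bound, because the tangent is taken at `a`. -/
lemma transform_sub_le {T : ℝ} (hT : 0 < T) {a : ℝ} (b : ℝ) (ha : a ≤ 1) :
    transform T a - transform T b ≤ nu T * |a - b| := by
  refine (transform_sub_le_tangent T a b).trans ?_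
  rw [nu, mul_comm (1 / T)]
  have hexp : Real.exp (a / T) ≤ Real.exp (1 / T) := Real.exp_le_exp.2 (by gcongr)
  calc Real.exp (a / T) * (1 / T) * (a - b) ≤ Real.exp (a / T) * (1 / T) * |a - b| := by
        exact mul_le_mul_of_nonneg_left (le_abs_self _) (by positivity)
    _ ≤ Real.exp (1 / T) * (1 / T) * |a - b| := by gcongr

lemma nu_pos {T : ℝ} (hT : 0 < T) : 0 < nu T := by unfold nu; positivity

/-! ### Columns, the Frobenius ball and the empirical loss -/

/-- The `i`-th column of a matrix as a Euclidean vector. -/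
def column (Θ : Matrix (Fin d) (Fin m) ℝ) (i : Fin m) : EuclideanSpace ℝ (Fin d) :=
  WithLp.toLp 2 (fun k => Θ k i)

lemma abs_linearModel_le (Θ : Matrix (Fin d) (Fin m) ℝ) (i : Fin m)
    {x : EuclideanSpace ℝ (Fin d)} (hx : ‖x‖ ≤ 1) : |linearModel Θ i x| ≤ ‖column Θ i‖ :=
  (abs_real_inner_le_norm _ _).trans (mul_le_of_le_one_right (norm_nonneg _) hx)

@[simp]
lemma linearModel_zero (i : Fin m) (x : EuclideanSpace ℝ (Fin d)) :
    linearModel (0 : Matrix (Fin d) (Fin m) ℝ) i x = 0 := by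
  simp [linearModel, PiLp.inner_apply]

lemma continuous_linearModel_right (Θ : Matrix (Fin d) (Fin m) ℝ) (i : Fin m) :
    Continuous (linearModel Θ i) := by
  unfold linearModel; fun_prop

lemma continuous_linearModel_left (i : Fin m) (x : EuclideanSpace ℝ (Fin d)) :
    Continuous fun Θ : Matrix (Fin d) (Fin m) ℝ => linearModel Θ i x := by
  simp only [linearModel, PiLp.inner_apply]
  fun_prop

lemma sum_norm_column_le {Θ : Matrix (Fin d) (Fin m) ℝ} {β : ℝ} (hΘ : Θ ∈ constraintSet d m β) :
    ∑ i, ‖column Θ i‖ ≤ √m * β := by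
  have hsq : √(∑ i, ‖column Θ i‖ ^ 2) ≤ β := by
    have h : √(∑ k, ∑ i, ‖Θ k i‖ ^ (2 : ℝ)) ≤ β := by
      rw [Real.sqrt_eq_rpow, ← Matrix.frobenius_norm_def]
      exact hΘ
    convert h using 2
    rw [Finset.sum_comm]
    refine Finset.sum_congr rfl fun i _ => ?_
    simp [column, EuclideanSpace.norm_sq_eq]
  have hcs := Finset.sum_mul_sq_le_sq_mul_sq Finset.univ (fun _ : Fin m => (1 : ℝ))
    (fun i => ‖column Θ i‖)
  simp only [one_mul, one_pow, Finset.sum_const, Finset.card_univ, Fintype.card_fin,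
    nsmul_eq_mul, mul_one] at hcs
  calc ∑ i, ‖column Θ i‖ ≤ √(m * ∑ i, ‖column Θ i‖ ^ 2) := Real.le_sqrt_of_sq_le hcs
    _ = √m * √(∑ i, ‖column Θ i‖ ^ 2) := Real.sqrt_mul (Nat.cast_nonneg m) _
    _ ≤ √m * β := by gcongr

lemma abs_loss_sub_loss_zero_le {l : ℝ → 𝒴 → ℝ} {ρ : ℝ≥0}
    (hl_lip : ∀ y, LipschitzWith ρ (fun t => l t y)) (Θ : Matrix (Fin d) (Fin m) ℝ) (i : Fin m)
    {x : EuclideanSpace ℝ (Fin d)} (hx : ‖x‖ ≤ 1) (y : 𝒴) :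
    |l (linearModel Θ i x) y - l 0 y| ≤ ρ * ‖column Θ i‖ := by
  have h := (hl_lip y).dist_le_mul (linearModel Θ i x) 0
  simp only [Real.dist_eq, sub_zero] at h
  exact h.trans (mul_le_mul_of_nonneg_left (abs_linearModel_le Θ i hx) ρ.2)

lemma abs_average_le {n : ℕ} (hn : 0 < n) {f : Fin n → ℝ} {C : ℝ} (hf : ∀ j, |f j| ≤ C) :
    |1 / (n : ℝ) * ∑ j, f j| ≤ C := by
  have hn' : (0 : ℝ) < n := Nat.cast_pos.2 hn
  rw [abs_mul, abs_of_pos (by positivity), one_div, inv_mul_le_iff₀ hn']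
  refine (Finset.abs_sum_le_sum_abs _ _).trans ((Finset.sum_le_sum fun j _ => hf j).trans ?_)
  simp

lemma abs_empTaskRisk_sub_zero_le (hn₀ : 0 < n₀) {l : ℝ → 𝒴 → ℝ} {ρ : ℝ≥0}
    (hl_lip : ∀ y, LipschitzWith ρ (fun t => l t y))
    {z : Fin m → Fin n₀ → EuclideanSpace ℝ (Fin d) × 𝒴} (hz : ∀ i j, ‖(z i j).1‖ ≤ 1)
    (Θ : Matrix (Fin d) (Fin m) ℝ) (i : Fin m) :
    |empTaskRisk l z Θ i - empTaskRisk l z 0 i| ≤ ρ * ‖column Θ i‖ := by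
  simp only [empTaskRisk, linearModel_zero, ← mul_sub, ← Finset.sum_sub_distrib]
  exact abs_average_le hn₀ fun j => abs_loss_sub_loss_zero_le hl_lip Θ i (hz i j) _

lemma empTaskRisk_le_one (hn₀ : 0 < n₀) {l : ℝ → 𝒴 → ℝ}
    (hl_mem : ∀ t y, l t y ∈ Set.Icc (0 : ℝ) 1)
    (z : Fin m → Fin n₀ → EuclideanSpace ℝ (Fin d) × 𝒴) (Θ : Matrix (Fin d) (Fin m) ℝ)
    (i : Fin m) : empTaskRisk l z Θ i ≤ 1 :=
  (le_abs_self _).trans <| abs_average_le hn₀ fun j =>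
    abs_le.2 ⟨by linarith [(hl_mem (linearModel Θ i (z i j).1) (z i j).2).1], (hl_mem _ _).2⟩

lemma continuous_empRisk (T : ℝ) {l : ℝ → 𝒴 → ℝ} {ρ : ℝ≥0}
    (hl_lip : ∀ y, LipschitzWith ρ (fun t => l t y))
    (z : Fin m → Fin n₀ → EuclideanSpace ℝ (Fin d) × 𝒴) : Continuous (empRisk T l z) := by
  have h : ∀ i j, Continuous fun Θ : Matrix (Fin d) (Fin m) ℝ =>
      l (linearModel Θ i (z i j).1) (z i j).2 := fun i j =>
    (hl_lip (z i j).2).continuous.comp (continuous_linearModel_left i (z i j).1)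
  exact continuous_const.mul <| continuous_finsetSum _ fun i _ => Real.continuous_exp.comp <|
    (continuous_const.mul (continuous_finsetSum _ fun j _ => h i j)).div_const T

/-! ### Expected loss and its comparison with the value at zero -/

section Measure

variable [MeasurableSpace 𝒴] {l : ℝ → 𝒴 → ℝ}

lemma measurable_loss (hl_meas : Measurable (Function.uncurry l))
    (Θ : Matrix (Fin d) (Fin m) ℝ) (i : Fin m) :
    Measurable fun z : EuclideanSpace ℝ (Fin d) × 𝒴 => l (linearModel Θ i z.1) z.2 :=
  hl_meas.comp (((continuous_linearModel_right Θ i).measurable.comp measurable_fst).prodMk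
    measurable_snd)

lemma integrable_loss (hl_meas : Measurable (Function.uncurry l))
    (hl_mem : ∀ t y, l t y ∈ Set.Icc (0 : ℝ) 1)
    (κ : Measure (EuclideanSpace ℝ (Fin d) × 𝒴)) [IsProbabilityMeasure κ]
    (Θ : Matrix (Fin d) (Fin m) ℝ) (i : Fin m) :
    Integrable (fun z => l (linearModel Θ i z.1) z.2) κ :=
  Integrable.of_mem_Icc 0 1 (measurable_loss hl_meas Θ i).aemeasurable
    (ae_of_all _ fun _ => hl_mem _ _)

lemma measurable_empRisk {Ω : Type*} [MeasurableSpace Ω] (T : ℝ)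
    (hl_meas : Measurable (Function.uncurry l))
    {Z : Fin m → Fin n₀ → Ω → EuclideanSpace ℝ (Fin d) × 𝒴} (hZ : ∀ i j, Measurable (Z i j))
    (Θ : Matrix (Fin d) (Fin m) ℝ) :
    Measurable fun ω => empRisk T l (fun i j => Z i j ω) Θ := by
  have h : ∀ i j, Measurable fun ω => l (linearModel Θ i (Z i j ω).1) (Z i j ω).2 :=
    fun i j => (measurable_loss hl_meas Θ i).comp (hZ i j)
  exact (Finset.measurable_sum _ fun i _ => Real.measurable_exp.comp <|
    ((Finset.measurable_sum _ fun j _ => h i j).const_mul _).div_const T).const_mul _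

/-- The tangent is taken at the deterministic point `R_i`, so the weights are nonrandom and the
right side is a sum over independent sample points. -/
lemma risk_sub_empRisk_le_sum (μ : Fin m → Measure (EuclideanSpace ℝ (Fin d) × 𝒴))
    (hn₀ : 0 < n₀) (T : ℝ)
    (z : Fin m → Fin n₀ → EuclideanSpace ℝ (Fin d) × 𝒴) (Θ : Matrix (Fin d) (Fin m) ℝ) :
    risk T l μ Θ - empRisk T l z Θ ≤ ∑ p : Fin m × Fin n₀,
      1 / (m : ℝ) * (Real.exp (taskRisk l μ Θ p.1 / T) * (1 / T)) * (1 / n₀) *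
        (taskRisk l μ Θ p.1 - l (linearModel Θ p.1 (z p.1 p.2).1) (z p.1 p.2).2) := by
  have hn' : (n₀ : ℝ) ≠ 0 := Nat.cast_ne_zero.2 hn₀.ne'
  rw [risk, empRisk, ← mul_sub, ← Finset.sum_sub_distrib, Finset.mul_sum, Fintype.sum_prod_type]
  refine Finset.sum_le_sum fun i _ => ?_
  have h := mul_le_mul_of_nonneg_left
    (transform_sub_le_tangent T (taskRisk l μ Θ i) (empTaskRisk l z Θ i))
    (one_div_nonneg.2 (Nat.cast_nonneg m) : (0 : ℝ) ≤ 1 / (m : ℝ))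
  refine h.trans_eq ?_
  dsimp only
  rw [← Finset.mul_sum, Finset.sum_sub_distrib, empTaskRisk]
  simp only [Finset.sum_const, Finset.card_univ, Fintype.card_fin, nsmul_eq_mul]
  field_simp

variable (μ : Fin m → Measure (EuclideanSpace ℝ (Fin d) × 𝒴)) [∀ i, IsProbabilityMeasure (μ i)]

instance : SecondCountableTopology (Matrix (Fin d) (Fin m) ℝ) :=
  inferInstanceAs (SecondCountableTopology (Fin d → Fin m → ℝ))

lemma continuous_risk (T : ℝ) (hl_meas : Measurable (Function.uncurry l))
    (hl_mem : ∀ t y, l t y ∈ Set.Icc (0 : ℝ) 1) {ρ : ℝ≥0}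
    (hl_lip : ∀ y, LipschitzWith ρ (fun t => l t y)) : Continuous (risk T l μ) := by
  have h : ∀ i, Continuous fun Θ => taskRisk l μ Θ i := fun i =>
    continuous_of_dominated (bound := fun _ => (1 : ℝ))
      (fun Θ => (measurable_loss hl_meas Θ i).aestronglyMeasurable)
      (fun Θ => ae_of_all _ fun z => by
        rw [Real.norm_eq_abs, abs_of_nonneg (hl_mem _ _).1]; exact (hl_mem _ _).2)
      (integrable_const _)
      (ae_of_all _ fun z => (hl_lip z.2).continuous.comp (continuous_linearModel_left i z.1))
  unfold risk transform
  fun_prop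

lemma taskRisk_le_one (hl_meas : Measurable (Function.uncurry l))
    (hl_mem : ∀ t y, l t y ∈ Set.Icc (0 : ℝ) 1) (Θ : Matrix (Fin d) (Fin m) ℝ) (i : Fin m) :
    taskRisk l μ Θ i ≤ 1 := by
  have h := integral_mono (integrable_loss hl_meas hl_mem (μ i) Θ i) (integrable_const (1 : ℝ))
    fun z => (hl_mem _ _).2
  simpa [taskRisk] using h

variable {μ} in
lemma abs_taskRisk_sub_zero_le (hl_meas : Measurable (Function.uncurry l))
    (hl_mem : ∀ t y, l t y ∈ Set.Icc (0 : ℝ) 1) {ρ : ℝ≥0}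
    (hl_lip : ∀ y, LipschitzWith ρ (fun t => l t y)) (hμ : ∀ i, ∀ᵐ z ∂(μ i), ‖z.1‖ ≤ 1)
    (Θ : Matrix (Fin d) (Fin m) ℝ) (i : Fin m) :
    |taskRisk l μ Θ i - taskRisk l μ 0 i| ≤ ρ * ‖column Θ i‖ := by
  rw [taskRisk, taskRisk, ← integral_sub (integrable_loss hl_meas hl_mem (μ i) Θ i)
    (integrable_loss hl_meas hl_mem (μ i) 0 i), ← Real.norm_eq_abs]
  refine (norm_integral_le_of_norm_le_const (C := ρ * ‖column Θ i‖) ?_).trans (by simp)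
  filter_upwards [hμ i] with z hz
  rw [linearModel_zero]
  exact abs_loss_sub_loss_zero_le hl_lip Θ i hz z.2

variable {μ} in
/-- On a sample in the unit ball, passing from `0` to `Θ` in the constraint set increases the gap
between expected and empirical loss by at most `2ρνβ/√m`. -/
lemma risk_sub_empRisk_le_at_zero (hm : 0 < m) (hn₀ : 0 < n₀) {T : ℝ} (hT : 0 < T) {β : ℝ}
    (hl_meas : Measurable (Function.uncurry l)) (hl_mem : ∀ t y, l t y ∈ Set.Icc (0 : ℝ) 1)
    {ρ : ℝ≥0} (hl_lip : ∀ y, LipschitzWith ρ (fun t => l t y))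
    (hμ : ∀ i, ∀ᵐ z ∂(μ i), ‖z.1‖ ≤ 1)
    {z : Fin m → Fin n₀ → EuclideanSpace ℝ (Fin d) × 𝒴} (hz : ∀ i j, ‖(z i j).1‖ ≤ 1)
    {Θ : Matrix (Fin d) (Fin m) ℝ} (hΘ : Θ ∈ constraintSet d m β) :
    risk T l μ Θ - empRisk T l z Θ ≤
      risk T l μ 0 - empRisk T l z 0 + 2 * ρ * nu T * β / √m := by
  have hm' : (0 : ℝ) < m := Nat.cast_pos.2 hm
  have hν := nu_pos hT
  have hterm : ∀ i, transform T (taskRisk l μ Θ i) - transform T (empTaskRisk l z Θ i) ≤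
      transform T (taskRisk l μ 0 i) - transform T (empTaskRisk l z 0 i) +
        2 * ρ * nu T * ‖column Θ i‖ := fun i => by
    -- The gap grows through a rise of `R_i` and a fall of its empirical counterpart, so the second
    -- tangent sits at the empirical loss of `0`.
    have h1 := transform_sub_le hT (taskRisk l μ 0 i) (taskRisk_le_one μ hl_meas hl_mem Θ i)
    have h2 := transform_sub_le hT (empTaskRisk l z Θ i) (empTaskRisk_le_one hn₀ hl_mem z 0 i)
    have h3 := mul_le_mul_of_nonneg_left
      (abs_taskRisk_sub_zero_le hl_meas hl_mem hl_lip hμ Θ i) hν.le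
    have h4 := mul_le_mul_of_nonneg_left (abs_empTaskRisk_sub_zero_le hn₀ hl_lip hz Θ i) hν.le
    rw [abs_sub_comm] at h4
    linarith
  have hsum := Finset.sum_le_sum fun i (_ : i ∈ Finset.univ) => hterm i
  simp only [Finset.sum_add_distrib, Finset.sum_sub_distrib, ← Finset.mul_sum] at hsum
  have hcol : 1 / (m : ℝ) * (2 * ρ * nu T * ∑ i, ‖column Θ i‖) ≤ 2 * ρ * nu T * β / √m := by
    calc 1 / (m : ℝ) * (2 * ρ * nu T * ∑ i, ‖column Θ i‖)
        ≤ 1 / (m : ℝ) * (2 * ρ * nu T * (√m * β)) := by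
          gcongr; exact sum_norm_column_le hΘ
      _ = 2 * ρ * nu T * β * (√m / m) := by ring
      _ = 2 * ρ * nu T * β / √m := by rw [Real.sqrt_div_self]; ring
  have := mul_le_mul_of_nonneg_left hsum (one_div_pos.2 hm').le
  simp only [risk, empRisk]
  linarith

/-! ### Measurability of the uniform event -/

/-- The event that the expected loss is bounded by the empirical loss plus constants, uniformly
over a set of parameters, is measurable. -/
lemma measurableSet_forall_risk_le {Ω : Type*} [MeasurableSpace Ω] (T : ℝ)
    (hl_meas : Measurable (Function.uncurry l)) (hl_mem : ∀ t y, l t y ∈ Set.Icc (0 : ℝ) 1)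
    {ρ : ℝ≥0} (hl_lip : ∀ y, LipschitzWith ρ (fun t => l t y))
    {Z : Fin m → Fin n₀ → Ω → EuclideanSpace ℝ (Fin d) × 𝒴} (hZ : ∀ i j, Measurable (Z i j))
    (C : Set (Matrix (Fin d) (Fin m) ℝ)) (a b : ℝ) :
    MeasurableSet {ω | ∀ Θ ∈ C,
      risk T l μ Θ ≤ empRisk T l (fun i j => Z i j ω) Θ + a + b} := by
  -- Both losses are continuous in `Θ`, so the inequality is a closed condition and a countable
  -- dense subset of `C` suffices.
  obtain ⟨D, hDc, hD⟩ := TopologicalSpace.exists_countable_dense C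
  have hset : {ω | ∀ Θ ∈ C, risk T l μ Θ ≤ empRisk T l (fun i j => Z i j ω) Θ + a + b} =
      ⋂ Θ ∈ D, {ω | risk T l μ Θ.1 ≤ empRisk T l (fun i j => Z i j ω) Θ.1 + a + b} := by
    ext ω
    simp only [Set.mem_ofPred_eq, Set.mem_iInter]
    refine ⟨fun h Θ _ => h Θ.1 Θ.2, fun h Θ hΘ => ?_⟩
    have hcl : IsClosed {Θ : C | risk T l μ Θ.1 ≤ empRisk T l (fun i j => Z i j ω) Θ.1 + a + b} :=
      isClosed_le ((continuous_risk μ T hl_meas hl_mem hl_lip).comp continuous_subtype_val)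
        ((((continuous_empRisk T hl_lip _).comp continuous_subtype_val).add
          continuous_const).add continuous_const)
    have hsub : D ⊆ {Θ : C | risk T l μ Θ.1 ≤ empRisk T l (fun i j => Z i j ω) Θ.1 + a + b} :=
      fun Θ' hΘ' => h Θ' hΘ'
    have hmem := hcl.closure_subset_iff.2 hsub (hD ⟨Θ, hΘ⟩)
    exact hmem
  rw [hset]
  exact MeasurableSet.biInter hDc fun Θ _ => measurableSet_le measurable_const
    (((measurable_empRisk T hl_meas hZ Θ.1).add_const a).add_const b)

/-! ### Concentration at a fixed parameter -/

/-- Hoeffding's bound for the gap between expected and empirical loss at a fixed `Θ`. -/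
lemma measureReal_risk_sub_empRisk_ge_le (hm : 0 < m) (hn₀ : 0 < n₀) {T : ℝ} (hT : 0 < T)
    (hl_meas : Measurable (Function.uncurry l)) (hl_mem : ∀ t y, l t y ∈ Set.Icc (0 : ℝ) 1)
    {Ω : Type*} [MeasurableSpace Ω] (P : Measure Ω) [IsProbabilityMeasure P]
    {Z : Fin m → Fin n₀ → Ω → EuclideanSpace ℝ (Fin d) × 𝒴} (hZ : ∀ i j, Measurable (Z i j))
    (hZ_law : ∀ i j, P.map (Z i j) = μ i)
    (hZ_indep : iIndepFun (fun (p : Fin m × Fin n₀) => Z p.1 p.2) P)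
    (Θ : Matrix (Fin d) (Fin m) ℝ) {ε : ℝ} (hε : 0 ≤ ε) :
    P.real {ω | ε ≤ risk T l μ Θ - empRisk T l (fun i j => Z i j ω) Θ} ≤
      Real.exp (-ε ^ 2 / (2 * (m * n₀ * (eta m n₀ T / 4) ^ 2))) := by
  have hm' : (0 : ℝ) < m := Nat.cast_pos.2 hm
  have hn' : (0 : ℝ) < n₀ := Nat.cast_pos.2 hn₀
  set R : Fin m → ℝ := fun i => taskRisk l μ Θ i with hR
  set k : Fin m → ℝ := fun i => 1 / (m : ℝ) * (Real.exp (R i / T) * (1 / T)) * (1 / n₀) with hk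
  -- The minus sign makes an upper tail of `∑ F` out of the empirical loss falling below its mean.
  set F : Fin m → EuclideanSpace ℝ (Fin d) × 𝒴 → ℝ :=
    fun i z => -(k i * l (linearModel Θ i z.1) z.2) with hF
  have hF_meas : ∀ i, Measurable (F i) := fun i =>
    ((measurable_loss hl_meas Θ i).const_mul (k i)).neg
  have hη : 0 ≤ eta m n₀ T / 2 := by
    have : 1 ≤ Real.exp (1 / ((n₀ : ℝ) * T)) := Real.one_le_exp (by positivity)
    have : 0 ≤ Real.exp (1 / ((n₀ : ℝ) * T)) - 1 := by linarith
    unfold eta; positivity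
  have hk0 : ∀ i, 0 ≤ k i := fun i => by positivity
  have hk1 : ∀ i, k i ≤ eta m n₀ T / 2 := fun i => by
    have h1 : Real.exp (R i / T) ≤ Real.exp (1 / T) :=
      Real.exp_le_exp.2 (by gcongr; exact taskRisk_le_one μ hl_meas hl_mem Θ i)
    -- The bound `x ≤ exp x - 1` puts the linearised weight below `η / 2`.
    have h2 : 1 / ((n₀ : ℝ) * T) ≤ Real.exp (1 / ((n₀ : ℝ) * T)) - 1 := by
      linarith [Real.add_one_le_exp (1 / ((n₀ : ℝ) * T))]
    calc k i = 1 / (m : ℝ) * (Real.exp (R i / T) * (1 / (n₀ * T))) := by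
          simp only [hk]; field_simp
      _ ≤ 1 / (m : ℝ) * (Real.exp (1 / T) * (Real.exp (1 / ((n₀ : ℝ) * T)) - 1)) := by gcongr
      _ = eta m n₀ T / 2 := by unfold eta; ring
  have hmean : ∀ p : Fin m × Fin n₀, P[fun ω => F p.1 (Z p.1 p.2 ω)] = -(k p.1 * R p.1) :=
    fun p => by
      rw [← integral_map (hZ p.1 p.2).aemeasurable (hF_meas p.1).aestronglyMeasurable,
        hZ_law, integral_neg, integral_const_mul]
      rfl
  -- Each `F` takes values in `[-η/2, 0]`, hence the sub-Gaussian parameter `(η/4)²`.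
  have hsub : ∀ p ∈ (Finset.univ : Finset (Fin m × Fin n₀)),
      HasSubgaussianMGF (fun ω => F p.1 (Z p.1 p.2 ω) - P[fun ω => F p.1 (Z p.1 p.2 ω)])
        ((‖0 - -(eta m n₀ T / 2)‖₊ / 2) ^ 2) P := fun p _ => by
    refine hasSubgaussianMGF_of_mem_Icc ((hF_meas p.1).comp (hZ p.1 p.2)).aemeasurable
      (ae_of_all _ fun ω => ?_)
    have hl := hl_mem (linearModel Θ p.1 (Z p.1 p.2 ω).1) (Z p.1 p.2 ω).2
    have h0 := mul_nonneg (hk0 p.1) hl.1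
    have h1 := (mul_le_of_le_one_right (hk0 p.1) hl.2).trans (hk1 p.1)
    exact ⟨by simp only [hF]; linarith, by simp only [hF]; linarith⟩
  have hind : iIndepFun (fun (p : Fin m × Fin n₀) ω =>
      F p.1 (Z p.1 p.2 ω) - P[fun ω => F p.1 (Z p.1 p.2 ω)]) P :=
    hZ_indep.comp (fun p z => F p.1 z - ∫ ω, F p.1 (Z p.1 p.2 ω) ∂P)
      fun p => (hF_meas p.1).sub_const _
  have hH := HasSubgaussianMGF.measure_sum_ge_le_of_iIndepFun hind hsub hε
  refine (measureReal_mono fun ω (hω : ε ≤ _) => ?_).trans (hH.trans_eq ?_)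
  · refine hω.trans ((risk_sub_empRisk_le_sum μ hn₀ T _ Θ).trans_eq ?_)
    refine Finset.sum_congr rfl fun p _ => ?_
    rw [hmean p]
    simp only [hF, hk, hR]
    ring
  · congr 3
    simp only [Finset.sum_const, Finset.card_univ, Fintype.card_prod, Fintype.card_fin]
    simp only [nsmul_eq_mul, NNReal.coe_mul, NNReal.coe_natCast, NNReal.coe_pow, NNReal.coe_div,
      coe_nnnorm, zero_sub, neg_neg, Real.norm_of_nonneg hη, NNReal.coe_ofNat, Nat.cast_mul]
    ring

end Measure

end BMTL

theorem theorem5 {d m n₀ : ℕ} (hm : 0 < m) (hn₀ : 0 < n₀)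
    {𝒴 : Type*} [MeasurableSpace 𝒴]
    {Ω : Type*} [MeasurableSpace Ω] (P : Measure Ω) [IsProbabilityMeasure P]
    (T : ℝ) (hT : 0 < T) (β : ℝ) (δ : ℝ) (hδ : 0 < δ)
    -- the loss: measurable, `[0,1]`-valued, `ρ`-Lipschitz in the first argument
    (l : ℝ → 𝒴 → ℝ) (hl_meas : Measurable (Function.uncurry l))
    (hl_mem : ∀ t y, l t y ∈ Set.Icc (0 : ℝ) 1)
    (ρ : ℝ≥0) (hl_lip : ∀ y, LipschitzWith ρ (fun t => l t y))
    -- the data distributions of the tasks, with inputs in the unit ball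
    (μ : Fin m → Measure (EuclideanSpace ℝ (Fin d) × 𝒴)) [∀ i, IsProbabilityMeasure (μ i)]
    (hμ : ∀ i, ∀ᵐ z ∂(μ i), ‖z.1‖ ≤ 1)
    -- the sample: independent pairs `Z i j = (x^i_j, y^i_j)` with law `μ i`
    (Z : Fin m → Fin n₀ → Ω → EuclideanSpace ℝ (Fin d) × 𝒴)
    (hZ_meas : ∀ i j, Measurable (Z i j))
    (hZ_law : ∀ i j, P.map (Z i j) = μ i)
    (hZ_indep : iIndepFun (fun (p : Fin m × Fin n₀) => Z p.1 p.2) P) :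
    MeasurableSet {ω | ∀ Θ ∈ BMTL.constraintSet d m β,
        BMTL.risk T l μ Θ ≤ BMTL.empRisk T l (fun i j => Z i j ω) Θ
          + 8 * (ρ : ℝ) * BMTL.nu T * β / √(m : ℝ)
          + √((BMTL.eta m n₀ T) ^ 2 * (m : ℝ) * (n₀ : ℝ) / 2 * Real.log (1 / δ))} ∧
      1 - δ ≤ P.real {ω | ∀ Θ ∈ BMTL.constraintSet d m β,
        BMTL.risk T l μ Θ ≤ BMTL.empRisk T l (fun i j => Z i j ω) Θ
          + 8 * (ρ : ℝ) * BMTL.nu T * β / √(m : ℝ)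
          + √((BMTL.eta m n₀ T) ^ 2 * (m : ℝ) * (n₀ : ℝ) / 2 * Real.log (1 / δ))} := by
  have hm' : (0 : ℝ) < m := Nat.cast_pos.2 hm
  have hn' : (0 : ℝ) < n₀ := Nat.cast_pos.2 hn₀
  refine ⟨BMTL.measurableSet_forall_risk_le μ T hl_meas hl_mem hl_lip hZ_meas _ _ _, ?_⟩
  set ε := √((BMTL.eta m n₀ T) ^ 2 * (m : ℝ) * (n₀ : ℝ) / 2 * Real.log (1 / δ)) with hε
  rcases le_or_gt 1 δ with hδ1 | hδ1
  · exact (sub_nonpos.2 hδ1).trans measureReal_nonneg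
  -- For `β < 0` the constraint set is empty; afterwards `β ≥ 0` allows `2` to be relaxed to `8`.
  rcases lt_or_ge β 0 with hβ | hβ
  · have hempty : ∀ Θ, Θ ∉ BMTL.constraintSet d m β := fun Θ hΘ => by
      have h : 0 ≤ √(m : ℝ) * β :=
        (Finset.sum_nonneg fun i _ => norm_nonneg _).trans (BMTL.sum_norm_column_le hΘ)
      exact absurd h (not_le.2 (mul_neg_of_pos_of_neg (Real.sqrt_pos.2 hm') hβ))
    simp [hempty, hδ.le]
  have hη : 0 < BMTL.eta m n₀ T := by
    have : 0 < Real.exp (1 / ((n₀ : ℝ) * T)) - 1 :=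
      sub_pos.2 (Real.one_lt_exp_iff.2 (by positivity))
    unfold BMTL.eta; positivity
  have hlog : 0 < Real.log (1 / δ) := Real.log_pos ((one_lt_div hδ).2 hδ1)
  have htail := BMTL.measureReal_risk_sub_empRisk_ge_le μ hm hn₀ hT hl_meas hl_mem P hZ_meas
    hZ_law hZ_indep 0 (Real.sqrt_nonneg _ : 0 ≤ ε)
  -- The exponent equals `-4 log (1/δ)`, so the tail is in fact at most `δ⁴`.
  have hexp : Real.exp (-ε ^ 2 / (2 * (m * n₀ * (BMTL.eta m n₀ T / 4) ^ 2))) ≤ δ := by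
    rw [← Real.le_log_iff_exp_le hδ, hε, Real.sq_sqrt (by positivity)]
    have : -((BMTL.eta m n₀ T) ^ 2 * (m : ℝ) * (n₀ : ℝ) / 2 * Real.log (1 / δ)) /
        (2 * (m * n₀ * (BMTL.eta m n₀ T / 4) ^ 2)) = -(4 * Real.log (1 / δ)) := by
      field_simp; ring
    rw [this]
    have : Real.log δ = -Real.log (1 / δ) := by simp
    linarith
  have hmeas : MeasurableSet {ω | ε ≤ BMTL.risk T l μ 0 -
      BMTL.empRisk T l (fun i j => Z i j ω) 0} :=
    measurableSet_le measurable_const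
      (measurable_const.sub (BMTL.measurable_empRisk T hl_meas hZ_meas 0))
  have hball : ∀ᵐ ω ∂P, ∀ i j, ‖(Z i j ω).1‖ ≤ 1 := by
    refine ae_all_iff.2 fun i => ae_all_iff.2 fun j => ?_
    have h := hμ i
    rw [← hZ_law i j] at h
    exact ae_of_ae_map (hZ_meas i j).aemeasurable h
  calc 1 - δ ≤ P.real {ω | ε ≤ BMTL.risk T l μ 0 -
        BMTL.empRisk T l (fun i j => Z i j ω) 0}ᶜ := by
        rw [probReal_compl_eq_one_sub hmeas]; linarith
    _ ≤ _ := by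
      refine ENNReal.toReal_mono (measure_ne_top _ _) (measure_mono_ae ?_)
      filter_upwards [hball] with ω hω hgap Θ hΘ
      have hgap' := not_le.1 (show ¬ ε ≤ BMTL.risk T l μ 0 -
        BMTL.empRisk T l (fun i j => Z i j ω) 0 from hgap)
      have h := BMTL.risk_sub_empRisk_le_at_zero hm hn₀ hT hl_meas hl_mem hl_lip hμ hω hΘ
      have hν := BMTL.nu_pos hT
      have hc : 2 * ρ * BMTL.nu T * β / √(m : ℝ) ≤ 8 * ρ * BMTL.nu T * β / √(m : ℝ) := by
        gcongr; norm_num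
      linarith
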